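/- There are absolute constants $c, C > 0$ such that the following holds for every integer $d \ge 1$ and every real $\alpha > 0$. Equip the cube $[0,1]^d$ with the metric $\|x-y\|_\infty$, and let $Z$ be the set of all Borel probability measures on $[0,1]^d$, equipped with the $1$-Wasserstein metric $$\rho(\mu,\nu) = \inf_{\pi} \int \|x-y\|_\infty \, d\pi(x,y),$$ where the infimum is over all couplings $\pi$ of $\mu$ and $\nu$. Then $$c\, s(Z,\alpha) \le A(Z,\alpha) \le C\, s(Z,\alpha) \qquad\text{and}\qquad c \min\left(\alpha^{-\frac{1}{d+1}},1\right) \le s(Z,\alpha) \le C \min\left(\alpha^{-\frac{1}{d+1}},1\right),$$ that is, $A(Z,\alpha) \asymp s(Z,\alpha) \asymp \min(\alpha^{-1/(d+1)},1)$ with absolute constants. Here: - The optimal accuracy is $A(Z,\alpha) = \inf_{\mathcal M} \sup_{x \in Z} \mathbb{E}\, \rho(\mathcal M(x),x)$, where the infimum is over all randomized maps $\mathcal M : Z \to Z$ that are $\alpha$-metrically private, i.e. satisfy $\Pr\{\mathcal M(x) \in S\} \le e^{\alpha \rho(x,x')} \Pr\{\mathcal M(x') \in S\}$ for all $x,x'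 \in Z$ and all Borel sets $S \subset Z$. - The entropic scale is $$s(Z,\alpha) = \inf\left\{ s>0 \;:\; N(B(x,r),s) \le e^{\alpha r} \text{ for all } x \in Z \text{ and all } r>0 \right\},$$ where $B(x,r) \subset Z$ is the closed ball, and $N(B,s)$ is the maximal cardinality of a subset of $B$ in which any two distinct points have distance strictly greater than $s$. -/

import Mathlib

open MeasureTheory ProbabilityTheory
open scoped ENNReal NNReal

section Wasserstein

/-- The transport cost `∫ ρ(x, y) dπ(x, y)`, minimized over all couplings `π` of `μ` and `ν`,
i.e. over all measures on `X × X` with marginals `μ` and `ν`. -/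
noncomputable def wassersteinEDist {X : Type*} [PseudoEMetricSpace X] [MeasurableSpace X]
    (μ ν : Measure X) : ℝ≥0∞ :=
  ⨅ (π : Measure (X × X)) (_ : π.fst = μ ∧ π.snd = ν), ∫⁻ p, edist p.1 p.2 ∂π

/-- The set of all (Borel) probability measures on `X`, as a type of its own, which is given the
`1`-Wasserstein metric below. -/
@[ext]
structure WassersteinSpace (X : Type*) [MeasurableSpace X] where
  /-- the underlying probability measure -/
  toProbabilityMeasure : ProbabilityMeasure X

theorem wassersteinEDist_le {X : Type*} [PseudoEMetricSpace X] [MeasurableSpace X]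
    {μ ν : Measure X} (π : Measure (X × X)) (h₁ : π.fst = μ)
    (h₂ : π.snd = ν) : wassersteinEDist μ ν ≤ ∫⁻ p, edist p.1 p.2 ∂π :=
  iInf₂_le π ⟨h₁, h₂⟩

variable {X : Type*} [MetricSpace X] [CompactSpace X] [MeasurableSpace X] [BorelSpace X]

theorem wassersteinEDist_self (μ : Measure X) : wassersteinEDist μ μ = 0 := by
  refine le_antisymm ?_ bot_le
  have hm : Measurable (fun x : X => (x, x)) := by fun_prop
  refine (wassersteinEDist_le (μ.map (fun x => (x, x))) ?_ ?_).trans ?_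
  · rw [Measure.fst, Measure.map_map measurable_fst hm]
    exact Measure.map_id
  · rw [Measure.snd, Measure.map_map measurable_snd hm]
    exact Measure.map_id
  · rw [lintegral_map (by fun_prop) hm]
    simp

theorem wassersteinEDist_comm_le (μ ν : Measure X) :
    wassersteinEDist μ ν ≤ wassersteinEDist ν μ := by
  refine le_iInf₂ fun π hπ => ?_
  refine (wassersteinEDist_le (π.map Prod.swap) ?_ ?_).trans ?_
  · rw [Measure.fst_map_swap]; exact hπ.2
  · rw [Measure.snd_map_swap]; exact hπ.1
  · rw [lintegral_map (by fun_prop) measurable_swap]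
    simp [edist_comm]

/-- Gluing of couplings. -/
theorem wassersteinEDist_triangle (μ ν κ : Measure X) [IsProbabilityMeasure μ]
    [IsProbabilityMeasure ν] [IsProbabilityMeasure κ] :
    wassersteinEDist μ κ ≤ wassersteinEDist μ ν + wassersteinEDist ν κ := by
  have hne : Nonempty X := nonempty_of_isProbabilityMeasure μ
  simp only [wassersteinEDist, ENNReal.iInf_add, ENNReal.add_iInf]
  refine le_iInf fun π₂ => le_iInf fun h₂ => le_iInf fun π₁ => le_iInf fun h₁ => ?_
  have i₁ : IsProbabilityMeasure π₁ :=
    ⟨by rw [← Measure.fst_univ, h₁.1]; exact measure_univ⟩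
  have i₂ : IsProbabilityMeasure π₂ :=
    ⟨by rw [← Measure.fst_univ, h₂.1]; exact measure_univ⟩
  set G : Measure ((X × X) × X) := π₁ ⊗ₘ (Kernel.prodMkLeft X π₂.condKernel) with hG
  have hm₁ : Measurable (fun p : (X × X) × X => (p.1.1, p.2)) := by fun_prop
  have hm₂ : Measurable (fun p : (X × X) × X => (p.1.2, p.2)) := by fun_prop
  have hG₁ : G.map Prod.fst = π₁ := Measure.fst_compProd _ _
  have hG₂ : G.map (fun p => (p.1.2, p.2)) = π₂ := by
    conv_rhs => rw [← π₂.disintegrate π₂.condKernel]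
    ext s hs
    rw [Measure.map_apply hm₂ hs, hG, Measure.compProd_apply (hm₂ hs), Measure.compProd_apply hs,
      h₂.1, ← h₁.2, Measure.snd, lintegral_map _ measurable_snd]
    · rfl
    · exact Kernel.measurable_kernel_prodMk_left hs
  refine (wassersteinEDist_le (G.map (fun p => (p.1.1, p.2))) ?_ ?_).trans ?_
  · rw [← h₁.1, ← hG₁, Measure.fst, Measure.fst, Measure.map_map measurable_fst hm₁,
      Measure.map_map measurable_fst measurable_fst]
    rfl
  · rw [← h₂.2]
    conv_rhs => rw [← hG₂]
    rw [Measure.snd, Measure.snd, Measure.map_map measurable_snd hm₁,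
      Measure.map_map measurable_snd hm₂]
    rfl
  · rw [lintegral_map (by fun_prop) hm₁]
    calc ∫⁻ p, edist p.1.1 p.2 ∂G
        ≤ ∫⁻ p, (edist p.1.1 p.1.2 + edist p.1.2 p.2) ∂G :=
          lintegral_mono fun p => edist_triangle _ _ _
      _ = ∫⁻ p, edist p.1.1 p.1.2 ∂G + ∫⁻ p, edist p.1.2 p.2 ∂G :=
          lintegral_add_left (by fun_prop) _
      _ = ∫⁻ p, edist p.1 p.2 ∂π₁ + ∫⁻ p, edist p.1 p.2 ∂π₂ := by
          congr 1
          · conv_rhs => rw [← hG₁]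
            rw [lintegral_map (by fun_prop) measurable_fst]
          · conv_rhs => rw [← hG₂]
            rw [lintegral_map (by fun_prop) hm₂]

theorem wassersteinEDist_ne_top (μ ν : Measure X) [IsProbabilityMeasure μ]
    [IsProbabilityMeasure ν] : wassersteinEDist μ ν ≠ ∞ := by
  refine ne_top_of_le_ne_top (b := Metric.ediam (Set.univ : Set X))
    (isCompact_univ.isBounded.ediam_ne_top) ?_
  refine (wassersteinEDist_le (μ.prod ν) (by simp) (by simp)).trans ?_
  refine (lintegral_mono fun p : X × X =>
    Metric.edist_le_ediam_of_mem (Set.mem_univ p.1) (Set.mem_univ p.2)).trans ?_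
  simp

theorem levyProkhorovEDist_eq_zero_of_wassersteinEDist (μ ν : Measure X)
    (h : wassersteinEDist μ ν = 0) : levyProkhorovEDist μ ν = 0 := by
  refine le_antisymm ?_ bot_le
  have key : ∀ (μ ν : Measure X), wassersteinEDist μ ν = 0 → ∀ (ε : ℝ≥0∞) (B : Set X),
      0 < ε → ε < ∞ → MeasurableSet B → μ B ≤ ν (Metric.thickening ε.toReal B) + ε := by
    intro μ ν h ε B hε hε' hB
    have hlt : wassersteinEDist μ ν < ε * ε := by
      rw [h]; exact ENNReal.mul_pos hε.ne' hε.ne'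
    simp only [wassersteinEDist, iInf_lt_iff] at hlt
    obtain ⟨π, ⟨h₁, h₂⟩, hπ⟩ := hlt
    have hT : MeasurableSet (Metric.thickening ε.toReal B) :=
      Metric.isOpen_thickening.measurableSet
    have hmarkov : π {p | ε ≤ edist p.1 p.2} ≤ ε := by
      have := (mul_meas_ge_le_lintegral (μ := π)
        (f := fun p : X × X => edist p.1 p.2) (by fun_prop) ε).trans hπ.le
      exact (ENNReal.mul_le_mul_iff_right hε.ne' hε'.ne).1 this
    rw [← h₁, ← h₂, Measure.fst_apply hB, Measure.snd_apply hT]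
    refine (measure_mono ?_).trans ((measure_union_le _ _).trans (by gcongr))
    intro p hp
    by_cases hd : ε ≤ edist p.1 p.2
    · exact Or.inr hd
    · refine Or.inl (Metric.mem_thickening_iff.2 ⟨p.1, hp, ?_⟩)
      rw [dist_comm, dist_edist]
      exact ENNReal.toReal_strict_mono hε'.ne (not_le.1 hd)
  refine levyProkhorovEDist_le_of_forall _ _ _ fun ε B hε hε' hB =>
    ⟨key μ ν h ε B hε hε' hB, key ν μ ?_ ε B hε hε' hB⟩
  exact le_antisymm ((wassersteinEDist_comm_le ν μ).trans h.le) bot_le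

/-- The `1`-Wasserstein metric on the probability measures on a compact metric space. -/
noncomputable instance : MetricSpace (WassersteinSpace X) where
  dist μ ν := (wassersteinEDist (μ.toProbabilityMeasure : Measure X)
    (ν.toProbabilityMeasure : Measure X)).toReal
  dist_self μ := by simp [wassersteinEDist_self]
  dist_comm μ ν := by
    congr 1
    exact le_antisymm (wassersteinEDist_comm_le _ _) (wassersteinEDist_comm_le _ _)
  dist_triangle μ ν κ := by
    rw [← ENNReal.toReal_add (wassersteinEDist_ne_top _ _) (wassersteinEDist_ne_top _ _)]
    exact ENNReal.toReal_mono
      (ENNReal.add_ne_top.2 ⟨wassersteinEDist_ne_top _ _, wassersteinEDist_ne_top _ _⟩)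
      (wassersteinEDist_triangle _ _ _)
  eq_of_dist_eq_zero {μ ν} h := by
    have h0 := levyProkhorovEDist_eq_zero_of_wassersteinEDist _ _
      (((ENNReal.toReal_eq_zero_iff _).1 h).resolve_right (wassersteinEDist_ne_top _ _))
    have h1 : LevyProkhorov.ofMeasure μ.toProbabilityMeasure
        = LevyProkhorov.ofMeasure ν.toProbabilityMeasure := by
      refine eq_of_dist_eq_zero ?_
      rw [LevyProkhorov.dist_probabilityMeasure_def]
      simp [levyProkhorovDist, h0]
    exact WassersteinSpace.ext (congrArg LevyProkhorov.toMeasure h1)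

end Wasserstein

section Privacy

variable {Z : Type*} [MetricSpace Z]

/-- A randomized algorithm `Z → Z` is given by the laws `M x` of its outputs, which are
probability measures on the Borel sets of `Z`. It is `α`-metrically private if
`P(M x ∈ S) ≤ exp (α ρ(x, x')) P(M x' ∈ S)` for all inputs and all measurable `S`. (This makes
`x ↦ M x S` continuous, hence `M` is automatically a Markov kernel.) -/
def IsMetricallyPrivate [MeasurableSpace Z] (α : ℝ) (M : Z → ProbabilityMeasure Z) : Prop :=
  ∀ x x' : Z, ∀ S : Set Z, MeasurableSet S →
    (M x : Measure Z) S ≤ ENNReal.ofReal (Real.exp (α * dist x x')) * (M x' : Measure Z) S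

variable (Z) in
/-- The optimal accuracy `A(Z, α) = inf_M sup_x E ρ(M x, x)`, the infimum being over all
`α`-metrically private mechanisms `M : Z → Z`, for the Borel `σ`-algebra of `Z`. -/
noncomputable def optimalAccuracy [MeasurableSpace Z] [BorelSpace Z] (α : ℝ) : ℝ≥0∞ :=
  ⨅ (M : Z → ProbabilityMeasure Z) (_ : IsMetricallyPrivate α M),
    ⨆ x : Z, ∫⁻ y, edist y x ∂(M x : Measure Z)

variable (Z) in
/-- The entropic scale `s(Z, α)`: the infimum of all `s > 0` such that `N(B(x, r), s) ≤ exp (α r)`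
for all `x` and all `r > 0`. Here `B(x, r)` is the closed ball, and the packing number is the
maximal cardinality of a subset whose points have distances strictly greater than `s`. -/
noncomputable def entropicScale (α : ℝ) : ℝ≥0∞ :=
  ⨅ (s : ℝ≥0) (_ : 0 < s ∧ ∀ x : Z, ∀ r : ℝ, 0 < r →
    ((Metric.packingNumber s (Metric.closedBall x r) : ℕ∞) : ℝ≥0∞) ≤
      ENNReal.ofReal (Real.exp (α * r))), (s : ℝ≥0∞)

end Privacy

/-- The unit cube `[0,1]^d`; the metric on this type is that of the `ℓ_∞` norm. -/
abbrev UnitCube (d : ℕ) : Type := Fin d → unitInterval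

/-- The space of all probability measures is equipped with the Borel `σ`-algebra of the
`1`-Wasserstein metric. -/
noncomputable instance {X : Type*} [MetricSpace X] [CompactSpace X] [MeasurableSpace X]
    [BorelSpace X] : MeasurableSpace (WassersteinSpace X) := borel _

instance {X : Type*} [MetricSpace X] [CompactSpace X] [MeasurableSpace X]
    [BorelSpace X] : BorelSpace (WassersteinSpace X) := ⟨rfl⟩

/-!
Everything rests on the metric entropy of the space `Z` of probability measures on the cube: up to
absolute constants in place of the base and the scale, `Z` has `exp (k ^ d)` points at scale `1 / k`.
Comparing `k ^ d` with `α / k` shows that the critical scale is `1 / k ≈ α ^ (-1 / (d + 1))`.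

*Upper bounds.* There is a `3 / k`-net of `Z` with at most `4 ^ k ^ d` points
(`exists_finset_card_le_forall_dist_le`). Indeed, a measure can be moved to the grid of mesh `1 / k`
at cost `1 / k`. List the `n = k ^ d` grid points in lexicographic order; the path through them has
length at most `2 n / k`, because only one step in `k` carries a digit and all the others have
length `1 / k`. Rounding the cumulative weights along this path down to multiples of `1 / n` costs at
most `1 / n` times the length of the path, i.e. `2 / k`
(`exists_wassersteinEDist_rounded_weights_le`), and the number of measures with weights in
`ℕ / n` is a binomial coefficient below `4 ^ n`. The net bounds the entropic scale, and the
exponential mechanism on the net bounds the optimal accuracy (`optimalAccuracy_le_of_net`).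

*Lower bounds.* Choose one of two points at distance `1 / (2 k)` in each of the `k ^ d` cells, and
put mass `k ^ (-d)` on each of them. The choices from a Gilbert–Varshamov code give
`exp (k ^ d / 10)` measures in a ball of radius `1 / (2 k)` with mutual distances at least `1 / (8 k)`
(`exists_separated_family`). This bounds the entropic scale by definition, and the optimal accuracy
by the packing argument (`le_optimalAccuracy_of_separated`).
-/

/-! ### Transport of sums of Dirac masses -/

section Transport

variable {X : Type*} [MetricSpace X] [CompactSpace X] [MeasurableSpace X] [BorelSpace X]

theorem wassersteinEDist_add_smul_dirac_le (κ : Measure X) (c : ℝ≥0∞) (x y : X) :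
    wassersteinEDist (κ + c • Measure.dirac x) (κ + c • Measure.dirac y) ≤ c * edist x y := by
  have hm : Measurable (fun x : X => (x, x)) := by fun_prop
  refine (wassersteinEDist_le (κ.map (fun x => (x, x)) + c • Measure.dirac (x, y)) ?_ ?_).trans ?_
  · rw [Measure.fst, Measure.map_add _ _ measurable_fst, Measure.map_map measurable_fst hm,
      Measure.map_smul, Measure.map_dirac' measurable_fst]
    congr 1
    exact Measure.map_id
  · rw [Measure.snd, Measure.map_add _ _ measurable_snd, Measure.map_map measurable_snd hm,
      Measure.map_smul, Measure.map_dirac' measurable_snd]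
    congr 1
    exact Measure.map_id
  · rw [lintegral_add_measure, lintegral_map (by fun_prop) hm, lintegral_smul_measure,
      lintegral_dirac' _ (by fun_prop)]
    simp

theorem wassersteinEDist_map_le (μ : Measure X) [IsProbabilityMeasure μ] {f : X → X}
    (hf : Measurable f) {δ : ℝ≥0∞} (h : ∀ x, edist x (f x) ≤ δ) :
    wassersteinEDist μ (μ.map f) ≤ δ := by
  have hm : Measurable (fun x : X => (x, f x)) := by fun_prop
  refine (wassersteinEDist_le (μ.map (fun x => (x, f x))) ?_ ?_).trans ?_
  · rw [Measure.fst, Measure.map_map measurable_fst hm]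
    exact Measure.map_id
  · rw [Measure.snd, Measure.map_map measurable_snd hm]
    rfl
  · rw [lintegral_map (by fun_prop) hm]
    refine (lintegral_mono h).trans ?_
    simp

/-- If `ν` is carried by `B` and `A` lies at distance at least `δ` from `B`, then transporting `μ`
to `ν` moves all of the mass of `A` by at least `δ`. -/
theorem mul_measure_le_wassersteinEDist (μ ν : Measure X) {A B : Set X} (hA : MeasurableSet A)
    (hB : MeasurableSet B) (hν : ν Bᶜ = 0) {δ : ℝ≥0∞}
    (hδ : ∀ x ∈ A, ∀ y ∈ B, δ ≤ edist x y) : δ * μ A ≤ wassersteinEDist μ ν := by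
  refine le_iInf₂ fun π hπ => ?_
  have h1 : μ A ≤ π {p | δ ≤ edist p.1 p.2} := by
    rw [← hπ.1, Measure.fst_apply hA]
    have h0 : π (Prod.snd ⁻¹' Bᶜ) = 0 := by
      rw [← Measure.snd_apply hB.compl, hπ.2, hν]
    calc π (Prod.fst ⁻¹' A) ≤ π ({p | δ ≤ edist p.1 p.2} ∪ Prod.snd ⁻¹' Bᶜ) := by
          refine measure_mono fun p hp => ?_
          by_cases hb : p.2 ∈ B
          · exact Or.inl (hδ _ hp _ hb)
          · exact Or.inr hb
      _ ≤ _ := (measure_union_le _ _).trans (by rw [h0, add_zero])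
  calc δ * μ A ≤ δ * π {p | δ ≤ edist p.1 p.2} := by gcongr
    _ ≤ _ := mul_meas_ge_le_lintegral (by fun_prop) δ

/-- Along a sequence of points `p`, the mass which exceeds a multiple of `1 / m` can be passed on
from each point to the next one. This turns a weighted sum of Dirac masses into one whose weights
are multiples of `1 / m`, and never moves more than `1 / m` over a step of the sequence. -/
theorem exists_wassersteinEDist_rounded_weights_le (p : ℕ → X) (w : ℕ → ℝ≥0) (n m : ℕ)
    (hm : 0 < m) (hw : ∑ i ∈ Finset.range n, w i = 1) :
    ∃ g : ℕ → ℕ, ∑ i ∈ Finset.range n, g i = m ∧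
      wassersteinEDist (∑ i ∈ Finset.range n, (w i : ℝ≥0∞) • Measure.dirac (p i))
        (∑ i ∈ Finset.range n, (((g i : ℝ≥0) / m : ℝ≥0) : ℝ≥0∞) • Measure.dirac (p i)) ≤
        (m : ℝ≥0∞)⁻¹ * ∑ i ∈ Finset.range n, edist (p i) (p (i + 1)) := by
  have hm0 : (m : ℝ≥0) ≠ 0 := by exact_mod_cast hm.ne'
  -- the cumulative weights, and their roundings
  set F : ℕ → ℝ≥0 := fun k => ∑ i ∈ Finset.range k, w i with hF
  set H : ℕ → ℕ := fun k => ⌊m * F k⌋₊ with hH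
  have hFs : ∀ k, F (k + 1) = F k + w k := fun k => Finset.sum_range_succ _ _
  have hHmono : ∀ k, H k ≤ H (k + 1) := fun k => by
    refine Nat.floor_le_floor ?_
    rw [hFs]; gcongr; exact le_self_add
  have hHF : ∀ k, (H k : ℝ≥0) / m ≤ F k := fun k => by
    rw [div_le_iff₀' (by positivity)]
    exact Nat.floor_le (by positivity)
  have hH0 : H 0 = 0 := by simp [hH, hF]
  have hHn : H n = m := by
    have : F n = 1 := hw
    simp [hH, this]
  -- the mass passed on to the point `p k`
  set e : ℕ → ℝ≥0 := fun k => F k - H k / m with he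
  have hFe : ∀ k, F k = H k / m + e k := fun k => (add_tsub_cancel_of_le (hHF k)).symm
  have hele : ∀ k, e k ≤ (m : ℝ≥0)⁻¹ := fun k => by
    have : m * F k ≤ H k + 1 := (Nat.lt_floor_add_one _).le
    rw [he, tsub_le_iff_left]
    rw [← one_div, ← add_div, le_div_iff₀' (by positivity)]
    exact this
  set g : ℕ → ℕ := fun k => H (k + 1) - H k with hg
  have hgH : ∀ k, g k + H k = H (k + 1) := fun k => Nat.sub_add_cancel (hHmono k)
  have hsum : ∀ k, ∑ i ∈ Finset.range k, g i = H k := by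
    intro k
    induction k with
    | zero => simp [hH0]
    | succ k ih => rw [Finset.sum_range_succ, ih, ← hgH k, add_comm]
  have hstep : ∀ k, e k + w k = (g k : ℝ≥0) / m + e (k + 1) := by
    intro k
    have h1 := hFs k
    rw [hFe, hFe k, ← hgH k] at h1
    push_cast at h1
    rw [add_div] at h1
    have h2 : (H k : ℝ≥0) / m + (e k + w k) = H k / m + (g k / m + e (k + 1)) := by
      rw [← add_assoc, ← h1]; ring
    exact add_left_cancel h2
  -- the state after the first `k` points have been processed
  set T : ℕ → Measure X := fun k =>
    (∑ i ∈ Finset.range k, (((g i : ℝ≥0) / m : ℝ≥0) : ℝ≥0∞) • Measure.dirac (p i)) +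
    (e k : ℝ≥0∞) • Measure.dirac (p k) +
    ∑ i ∈ Finset.Ico k n, (w i : ℝ≥0∞) • Measure.dirac (p i) with hT
  have hTstep : ∀ k < n, ∃ κ : Measure X,
      T k = κ + (e (k + 1) : ℝ≥0∞) • Measure.dirac (p k) ∧
      T (k + 1) = κ + (e (k + 1) : ℝ≥0∞) • Measure.dirac (p (k + 1)) := by
    intro k hk
    refine ⟨(∑ i ∈ Finset.range (k + 1), (((g i : ℝ≥0) / m : ℝ≥0) : ℝ≥0∞) • Measure.dirac (p i)) +
      ∑ i ∈ Finset.Ico (k + 1) n, (w i : ℝ≥0∞) • Measure.dirac (p i), ?_, ?_⟩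
    · simp only [hT]
      rw [← Finset.insert_Ico_add_one_left_eq_Ico hk, Finset.sum_insert (by simp),
        Finset.sum_range_succ]
      have h3 : (e k : ℝ≥0∞) • Measure.dirac (p k) + (w k : ℝ≥0∞) • Measure.dirac (p k) =
          (((g k : ℝ≥0) / m : ℝ≥0) : ℝ≥0∞) • Measure.dirac (p k) +
            (e (k + 1) : ℝ≥0∞) • Measure.dirac (p k) := by
        rw [← add_smul, ← add_smul, ← ENNReal.coe_add, ← ENNReal.coe_add, hstep]
      rw [add_assoc, ← add_assoc (_ • _), h3]
      abel
    · simp only [hT]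
      abel
  have hprob0 : IsProbabilityMeasure (T 0) := by
    constructor
    simp only [hT, Measure.coe_add, Pi.add_apply, Measure.smul_apply, Measure.coe_finsetSum,
      Finset.sum_apply, measure_univ, smul_eq_mul, mul_one, Finset.range_zero, Finset.sum_empty]
    have he0 : e 0 = 0 := by simp [he, hF]
    rw [he0, ← Finset.range_eq_Ico, ← ENNReal.ofNNReal_finsetSum, hw]
    simp
  have hprob : ∀ k ≤ n, IsProbabilityMeasure (T k) := by
    intro k
    induction k with
    | zero => exact fun _ => hprob0
    | succ k ih =>
      intro hk
      have hk' := ih (by omega)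
      obtain ⟨κ, h1, h2⟩ := hTstep k (by omega)
      constructor
      have := hk'.measure_univ
      rw [h1] at this
      rw [h2, ← this]
      simp
  have hind : ∀ k ≤ n, wassersteinEDist (T 0) (T k) ≤
      (m : ℝ≥0∞)⁻¹ * ∑ i ∈ Finset.range k, edist (p i) (p (i + 1)) := by
    intro k
    induction k with
    | zero => intro _; simp [wassersteinEDist_self]
    | succ k ih =>
      intro hk
      have i1 := hprob k (by omega)
      have i2 := hprob (k + 1) hk
      refine (wassersteinEDist_triangle _ (T k) _).trans ?_
      rw [Finset.sum_range_succ, mul_add]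
      refine add_le_add (ih (by omega)) ?_
      obtain ⟨κ, h1, h2⟩ := hTstep k (by omega)
      rw [h1, h2]
      refine (wassersteinEDist_add_smul_dirac_le _ _ _ _).trans ?_
      gcongr
      have := ENNReal.coe_le_coe.2 (hele (k + 1))
      rwa [ENNReal.coe_inv hm0, ENNReal.coe_natCast] at this
  refine ⟨g, by rw [hsum, hHn], ?_⟩
  have hT0 : T 0 = ∑ i ∈ Finset.range n, (w i : ℝ≥0∞) • Measure.dirac (p i) := by
    have he0 : e 0 = 0 := by simp [he, hF]
    simp [hT, he0]
  have hTn : T n =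
      ∑ i ∈ Finset.range n, (((g i : ℝ≥0) / m : ℝ≥0) : ℝ≥0∞) • Measure.dirac (p i) := by
    have hen : e n = 0 := by
      have : F n = 1 := hw
      simp [he, hHn, this, hm0]
    simp [hT, hen]
  rw [← hT0, ← hTn]
  exact hind n le_rfl

end Transport

/-! ### The grid in lexicographic order -/

section Grid

/-- The points of the grid of mesh `1 / k` in the cube in lexicographic order: the coordinates of
the `j`-th point are the digits of `j` in base `k`, divided by `k`. This is periodic in `j`, with
period `k ^ d`. -/
noncomputable def gridPoint (d k j : ℕ) : UnitCube d := fun i =>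
  ⟨((j / k ^ (i : ℕ) % k : ℕ) : ℝ) / k, by positivity, by
    rcases Nat.eq_zero_or_pos k with rfl | hk
    · simp
    · rw [div_le_one (by positivity)]
      exact_mod_cast (Nat.mod_lt _ hk).le⟩

theorem edist_unitCube_le_ofReal {d : ℕ} {x y : UnitCube d} {r : ℝ} (hr : 0 ≤ r)
    (h : ∀ i, |(x i : ℝ) - y i| ≤ r) : edist x y ≤ ENNReal.ofReal r := by
  rw [edist_dist]
  refine ENNReal.ofReal_le_ofReal ((dist_pi_le_iff hr).2 fun i => ?_)
  rw [Subtype.dist_eq, Real.dist_eq]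
  exact h i

theorem edist_unitCube_le_one {d : ℕ} (x y : UnitCube d) : edist x y ≤ 1 := by
  have := edist_unitCube_le_ofReal (x := x) (y := y) zero_le_one fun i => by
    have h1 := (x i).2; have h2 := (y i).2
    rw [abs_le]; constructor <;> linarith [h1.1, h1.2, h2.1, h2.2]
  simpa using this

/-- A step which carries no digit changes one coordinate by `1 / k`; the others are
bounded by the diameter of the cube. -/
theorem edist_gridPoint_succ_le (d k j : ℕ) (hk : 1 ≤ k) :
    edist (gridPoint d k j) (gridPoint d k (j + 1)) ≤
      (k : ℝ≥0∞)⁻¹ + if k ∣ j + 1 then 1 else 0 := by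
  split_ifs with h
  · exact (edist_unitCube_le_one _ _).trans le_add_self
  · have hk0 : (0 : ℝ) < k := by exact_mod_cast hk
    have : ENNReal.ofReal (1 / k) = (k : ℝ≥0∞)⁻¹ := by
      rw [one_div, ENNReal.ofReal_inv_of_pos hk0, ENNReal.ofReal_natCast]
    rw [add_zero, ← this]
    refine edist_unitCube_le_ofReal (by positivity) fun i => ?_
    simp only [gridPoint]
    rw [← sub_div, abs_div, abs_of_pos hk0]
    gcongr
    rcases Nat.eq_zero_or_pos (i : ℕ) with hi | hi
    · rw [hi, pow_zero, Nat.div_one, Nat.div_one]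
      have h1 : (j + 1) % k = j % k + 1 := by
        have hlt := Nat.mod_lt j (show k > 0 by omega)
        rw [Nat.add_mod]
        rcases Nat.lt_or_ge 1 k with h1 | h1
        · rw [Nat.mod_eq_of_lt h1]
          rcases Nat.lt_or_ge (j % k + 1) k with h2 | h2
          · exact Nat.mod_eq_of_lt h2
          · exfalso
            apply h
            rw [Nat.dvd_iff_mod_eq_zero, Nat.add_mod, Nat.mod_eq_of_lt h1,
              show j % k + 1 = k by omega, Nat.mod_self]
        · exfalso
          apply h
          rw [show k = 1 by omega]
          exact one_dvd _
      rw [h1]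
      push_cast
      simp
    · have h1 : (j + 1) / k ^ (i : ℕ) = j / k ^ (i : ℕ) := by
        rw [Nat.succ_div, if_neg, add_zero]
        exact fun hd => h ((dvd_pow_self k hi.ne').trans hd)
      rw [h1]
      simp

/-- Only every `k`-th step of the lexicographic order carries a digit. -/
theorem sum_edist_gridPoint_le (d k : ℕ) (hk : 1 ≤ k) :
    ∑ j ∈ Finset.range (k ^ (d + 1)),
      edist (gridPoint (d + 1) k j) (gridPoint (d + 1) k (j + 1)) ≤ 2 * k ^ d := by
  refine (Finset.sum_le_sum fun j _ => edist_gridPoint_succ_le (d + 1) k j hk).trans ?_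
  have hk0 : (k : ℝ≥0∞) ≠ 0 := by exact_mod_cast (by omega : k ≠ 0)
  have hdiv : k ^ (d + 1) / k = k ^ d := by rw [pow_succ, Nat.mul_div_cancel _ hk]
  rw [Finset.sum_add_distrib, Finset.sum_const, Finset.card_range, ← Finset.sum_filter,
    Finset.sum_const, Nat.card_multiples, hdiv, nsmul_eq_mul, nsmul_eq_mul, mul_one, Nat.cast_pow, pow_succ, mul_assoc,
    ENNReal.mul_inv_cancel hk0 (ENNReal.natCast_ne_top k), mul_one, Nat.cast_pow, two_mul]

/-- The index of the cell, among the cells of side `1 / k`, which contains `x`. -/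
noncomputable def cellIndex (d k : ℕ) [NeZero k] (x : UnitCube d) : ℕ :=
  finFunctionFinEquiv (fun i => (⟨min ⌊k * (x i : ℝ)⌋₊ (k - 1), by
    have := NeZero.pos k; omega⟩ : Fin k))

theorem cellIndex_lt (d k : ℕ) [NeZero k] (x : UnitCube d) : cellIndex d k x < k ^ d :=
  Fin.is_lt _

theorem measurable_cellIndex (d k : ℕ) [NeZero k] : Measurable (cellIndex d k) := by
  have h : Measurable fun x : UnitCube d => fun i => (⟨min ⌊k * (x i : ℝ)⌋₊ (k - 1), by
      have := NeZero.pos k; omega⟩ : Fin k) := by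
    refine measurable_pi_lambda _ fun i => ?_
    refine measurable_to_countable' fun c => ?_
    have : Measurable fun x : UnitCube d => min ⌊k * (x i : ℝ)⌋₊ (k - 1) := by
      refine Measurable.min ?_ measurable_const
      exact Nat.measurable_floor.comp (by fun_prop)
    convert this (measurableSet_singleton (c : ℕ)) using 1
    ext x
    simp [Fin.ext_iff]
  exact (measurable_of_countable
    (fun f : Fin d → Fin k => (finFunctionFinEquiv f : ℕ))).comp h

theorem gridPoint_cellIndex_apply (d k : ℕ) [NeZero k] (x : UnitCube d) (i : Fin d) :
    (gridPoint d k (cellIndex d k x) i : ℝ) = (min ⌊k * (x i : ℝ)⌋₊ (k - 1) : ℕ) / k := by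
  set f : Fin d → Fin k := fun i => (⟨min ⌊k * (x i : ℝ)⌋₊ (k - 1), by
    have := NeZero.pos k; omega⟩ : Fin k) with hf
  have h := congrFun (finFunctionFinEquiv.symm_apply_apply f) i
  have h2 := congrArg Fin.val h
  rw [finFunctionFinEquiv_symm_apply_val] at h2
  simp only [gridPoint, cellIndex]
  rw [h2]

theorem edist_gridPoint_cellIndex_le (d k : ℕ) [NeZero k] (x : UnitCube d) :
    edist x (gridPoint d k (cellIndex d k x)) ≤ (k : ℝ≥0∞)⁻¹ := by
  have hk : 1 ≤ k := NeZero.one_le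
  have hk0 : (0 : ℝ) < k := by exact_mod_cast hk
  have : ENNReal.ofReal (1 / k) = (k : ℝ≥0∞)⁻¹ := by
    rw [one_div, ENNReal.ofReal_inv_of_pos hk0, ENNReal.ofReal_natCast]
  rw [← this]
  refine edist_unitCube_le_ofReal (by positivity) fun i => ?_
  rw [gridPoint_cellIndex_apply]
  have hx := (x i).2
  have h0 : (0 : ℝ) ≤ k * (x i : ℝ) := mul_nonneg hk0.le hx.1
  have h1 := Nat.floor_le h0
  have h2 := Nat.lt_floor_add_one (k * (x i : ℝ))
  have h3 : (k : ℝ) * (x i : ℝ) ≤ k := mul_le_of_le_one_right hk0.le hx.2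
  set m := ⌊k * (x i : ℝ)⌋₊
  have h4 : ((min m (k - 1) : ℕ) : ℝ) ≤ k * (x i : ℝ) :=
    le_trans (by exact_mod_cast min_le_left _ _) h1
  have h5 : k * (x i : ℝ) ≤ ((min m (k - 1) : ℕ) : ℝ) + 1 := by
    rcases le_total m (k - 1) with h | h
    · rw [min_eq_left h]; exact h2.le
    · rw [min_eq_right h, Nat.cast_sub hk]
      push_cast; linarith
  rw [show (x i : ℝ) - (min m (k - 1) : ℕ) / k = (k * (x i : ℝ) - (min m (k - 1) : ℕ)) / k by
    field_simp, abs_div, abs_of_pos hk0, abs_of_nonneg (by linarith)]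
  gcongr
  linarith

theorem map_comp_eq_sum_smul_dirac {X Y : Type*} [MeasurableSpace X] [MeasurableSpace Y]
    (μ : Measure X) {j : X → ℕ} (hj : Measurable j) (p : ℕ → Y) {n : ℕ} (hn : ∀ x, j x < n) :
    μ.map (fun x => p (j x)) =
      ∑ i ∈ Finset.range n, μ (j ⁻¹' {i}) • Measure.dirac (p i) := by
  classical
  ext S hS
  have hp : Measurable (fun x => p (j x)) := (measurable_of_countable p).comp hj
  rw [Measure.map_apply hp hS]
  simp only [Measure.coe_finsetSum, Finset.sum_apply, Measure.smul_apply, smul_eq_mul,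
    Measure.dirac_apply' _ hS, Set.indicator_apply, Pi.one_apply, mul_ite, mul_one, mul_zero]
  rw [← Finset.sum_filter, sum_measure_preimage_singleton _
    fun i _ => hj (measurableSet_singleton i)]
  congr 1
  ext x
  simp [hn x]

end Grid

/-! ### A net in the space of probability measures -/

section Net

/-- The empirical measure with `g i` atoms, each of mass `1 / n`, at the `i`-th grid point, where
`n = k ^ d` is the number of grid points. -/
noncomputable def gridMeasure (d k : ℕ) (g : ℕ →₀ ℕ) : Measure (UnitCube d) :=
  ∑ i ∈ Finset.range (k ^ d),
    (((g i : ℝ≥0) / (k ^ d : ℕ) : ℝ≥0) : ℝ≥0∞) • Measure.dirac (gridPoint d k i)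

theorem isProbabilityMeasure_gridMeasure {d k : ℕ} [NeZero k] {g : ℕ →₀ ℕ}
    (hg : g ∈ (Finset.range (k ^ d)).finsuppAntidiag (k ^ d)) :
    IsProbabilityMeasure (gridMeasure d k g) := by
  constructor
  rw [Finset.mem_finsuppAntidiag] at hg
  simp only [gridMeasure, Measure.coe_finsetSum, Finset.sum_apply, Measure.smul_apply,
    measure_univ, smul_eq_mul, mul_one]
  rw [← ENNReal.ofNNReal_finsetSum, ← Finset.sum_div, ← Nat.cast_sum, hg.1, div_self]
  · rfl
  · exact_mod_cast (pow_pos (NeZero.pos k) d).ne'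

/-- The space of probability measures on the cube has a net at scale `3 / k` whose size is
exponential in the number `k ^ d` of grid points, with no logarithmic loss: the multiples of
`k ^ (-d)` suffice as weights. -/
theorem exists_finset_card_le_forall_dist_le (d k : ℕ) (hd : 1 ≤ d) (hk : 1 ≤ k) :
    ∃ T : Finset (WassersteinSpace (UnitCube d)), T.card ≤ 4 ^ k ^ d ∧
      ∀ μ, ∃ ν ∈ T, dist μ ν ≤ 3 / k := by
  classical
  have : NeZero k := ⟨by omega⟩
  obtain ⟨d, rfl⟩ : ∃ e, d = e + 1 := ⟨d - 1, by omega⟩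
  set n := k ^ (d + 1) with hn
  have hnpos : 0 < n := pow_pos (NeZero.pos k) _
  let z : (Finset.range n).finsuppAntidiag n → WassersteinSpace (UnitCube (d + 1)) :=
    fun g => ⟨⟨gridMeasure (d + 1) k g.1, isProbabilityMeasure_gridMeasure g.2⟩⟩
  refine ⟨Finset.univ.image z, ?_, fun μ => ?_⟩
  · refine Finset.card_image_le.trans ?_
    rw [Finset.card_univ, Fintype.card_coe, Finset.card_finsuppAntidiag_nat_eq_choose,
      Finset.card_range]
    calc (n + n - 1).choose n ≤ 2 ^ (n + n - 1) := Nat.choose_le_two_pow _ _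
      _ ≤ 2 ^ (2 * n) := Nat.pow_le_pow_right (by norm_num) (by omega)
      _ = 4 ^ n := by rw [pow_mul]; norm_num
  · set κ : Measure (UnitCube (d + 1)) := (μ.toProbabilityMeasure : Measure (UnitCube (d + 1))) with hκ
    have hj := measurable_cellIndex (d + 1) k
    set j := cellIndex (d + 1) k with hjdef
    set p := gridPoint (d + 1) k with hp
    have hf : Measurable (fun x => p (j x)) := (measurable_of_countable p).comp hj
    set w : ℕ → ℝ≥0 := fun i => (κ (j ⁻¹' {i})).toNNReal with hw
    have hwc : ∀ i, (w i : ℝ≥0∞) = κ (j ⁻¹' {i}) := fun i =>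
      ENNReal.coe_toNNReal (measure_ne_top _ _)
    have hmap : κ.map (fun x => p (j x)) =
        ∑ i ∈ Finset.range n, (w i : ℝ≥0∞) • Measure.dirac (p i) := by
      simp_rw [hwc]
      exact map_comp_eq_sum_smul_dirac κ hj p (cellIndex_lt (d + 1) k)
    have hw1 : ∑ i ∈ Finset.range n, w i = 1 := by
      have h1 : IsProbabilityMeasure (κ.map (fun x => p (j x))) :=
        Measure.isProbabilityMeasure_map hf.aemeasurable
      have h2 := h1.measure_univ
      rw [hmap] at h2
      simp only [Measure.coe_finsetSum, Finset.sum_apply, Measure.smul_apply,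
        measure_univ, smul_eq_mul, mul_one] at h2
      exact_mod_cast h2
    obtain ⟨g, hg, hcost⟩ := exists_wassersteinEDist_rounded_weights_le p w n n hnpos hw1
    set g' : ℕ →₀ ℕ := Finsupp.indicator (Finset.range n) (fun i _ => g i) with hg'
    have hgg : ∀ i ∈ Finset.range n, g' i = g i := fun i hi => by
      rw [hg', Finsupp.indicator_of_mem hi]
    have hmem : g' ∈ (Finset.range n).finsuppAntidiag n := by
      rw [Finset.mem_finsuppAntidiag]
      exact ⟨by rw [Finset.sum_congr rfl hgg, hg], Finsupp.support_indicator_subset _ _⟩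
    refine ⟨z ⟨g', hmem⟩, Finset.mem_image_of_mem _ (Finset.mem_univ _), ?_⟩
    have hgm : gridMeasure (d + 1) k g' = ∑ i ∈ Finset.range n,
        (((g i : ℝ≥0) / n : ℝ≥0) : ℝ≥0∞) • Measure.dirac (p i) :=
      Finset.sum_congr rfl fun i hi => by rw [hgg i hi]
    have i1 : IsProbabilityMeasure (κ.map (fun x => p (j x))) :=
      Measure.isProbabilityMeasure_map hf.aemeasurable
    have i2 := isProbabilityMeasure_gridMeasure hmem
    have hk0 : (k : ℝ≥0∞) ≠ 0 := by exact_mod_cast (NeZero.ne k)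
    have key : wassersteinEDist κ (gridMeasure (d + 1) k g') ≤ 3 / k := by
      refine (wassersteinEDist_triangle _ (κ.map (fun x => p (j x))) _).trans ?_
      have h1 := wassersteinEDist_map_le κ hf (edist_gridPoint_cellIndex_le (d + 1) k)
      have h2 : wassersteinEDist (κ.map (fun x => p (j x))) (gridMeasure (d + 1) k g') ≤
          2 * (k : ℝ≥0∞)⁻¹ := by
        rw [hmap, hgm]
        refine hcost.trans ?_
        calc (n : ℝ≥0∞)⁻¹ * ∑ i ∈ Finset.range n, edist (p i) (p (i + 1))
            ≤ (n : ℝ≥0∞)⁻¹ * (2 * k ^ d) := by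
              gcongr; exact sum_edist_gridPoint_le d k (by omega)
          _ = 2 * (k : ℝ≥0∞)⁻¹ := by
              have hkd : ((k : ℝ≥0∞) ^ d) ≠ 0 := pow_ne_zero _ hk0
              have hkt : ((k : ℝ≥0∞) ^ d) ≠ ∞ := ENNReal.pow_ne_top (ENNReal.natCast_ne_top k)
              rw [hn, Nat.cast_pow, pow_succ, ENNReal.mul_inv (Or.inl hkd) (Or.inl hkt)]
              calc _ = (((k : ℝ≥0∞) ^ d)⁻¹ * k ^ d) * (2 * (k : ℝ≥0∞)⁻¹) := by ring
                _ = _ := by rw [ENNReal.inv_mul_cancel hkd hkt, one_mul]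
      refine (add_le_add h1 h2).trans (le_of_eq ?_)
      rw [div_eq_mul_inv]
      ring
    have h3 : (3 / k : ℝ≥0∞) = ENNReal.ofReal (3 / k) := by
      rw [ENNReal.ofReal_div_of_pos (by exact_mod_cast hk), ENNReal.ofReal_natCast]
      norm_num
    rw [h3] at key
    exact ENNReal.toReal_le_of_le_ofReal (by positivity) key

end Net

/-! ### The exponential mechanism -/

section ExponentialMechanism

variable {Z : Type*} [MetricSpace Z]

/-- The unnormalized weight with which the exponential mechanism at the input `x` outputs `y`. -/
noncomputable def expWeight (α : ℝ) (x y : Z) : ℝ := Real.exp (-(α * dist x y / 2))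

theorem expWeight_pos (α : ℝ) (x y : Z) : 0 < expWeight α x y := Real.exp_pos _

theorem expWeight_le_mul {α : ℝ} (hα : 0 ≤ α) (x x' y : Z) :
    expWeight α x y ≤ Real.exp (α * dist x x' / 2) * expWeight α x' y := by
  rw [expWeight, expWeight, ← Real.exp_add]
  refine Real.exp_le_exp.2 ?_
  have := mul_le_mul_of_nonneg_left (dist_triangle_left x' y x) hα
  nlinarith

/-- The normalizing factor of the exponential mechanism with outputs in `T`. -/
noncomputable def expPartition (α : ℝ) (T : Finset Z) (x : Z) : ℝ := ∑ y ∈ T, expWeight α x y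

theorem expPartition_pos (α : ℝ) {T : Finset Z} (hT : T.Nonempty) (x : Z) :
    0 < expPartition α T x :=
  Finset.sum_pos (fun y _ => expWeight_pos α x y) hT

theorem expPartition_le_mul {α : ℝ} (hα : 0 ≤ α) (T : Finset Z) (x x' : Z) :
    expPartition α T x ≤ Real.exp (α * dist x x' / 2) * expPartition α T x' := by
  rw [expPartition, expPartition, Finset.mul_sum]
  exact Finset.sum_le_sum fun y _ => expWeight_le_mul hα x x' y

variable [MeasurableSpace Z]

/-- The exponential mechanism: the output is a point `y` of the finite set `T`, drawn with
probability proportional to `exp (-α ρ(x, y) / 2)`. -/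
noncomputable def expMechanism (α : ℝ) (T : Finset Z) (hT : T.Nonempty) (x : Z) :
    ProbabilityMeasure Z :=
  ⟨∑ y ∈ T, ENNReal.ofReal (expWeight α x y / expPartition α T x) • Measure.dirac y, by
    constructor
    simp only [Measure.coe_finsetSum, Finset.sum_apply, Measure.smul_apply, measure_univ,
      smul_eq_mul, mul_one]
    rw [← ENNReal.ofReal_sum_of_nonneg fun y _ =>
        div_nonneg (expWeight_pos α x y).le (expPartition_pos α hT x).le,
      ← Finset.sum_div, ← expPartition, div_self (expPartition_pos α hT x).ne',
      ENNReal.ofReal_one]⟩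

theorem coe_expMechanism (α : ℝ) (T : Finset Z) (hT : T.Nonempty) (x : Z) :
    (expMechanism α T hT x : Measure Z) =
      ∑ y ∈ T, ENNReal.ofReal (expWeight α x y / expPartition α T x) • Measure.dirac y := rfl

theorem isMetricallyPrivate_expMechanism {α : ℝ} (hα : 0 ≤ α) {T : Finset Z} (hT : T.Nonempty) :
    IsMetricallyPrivate α (expMechanism α T hT) := by
  intro x x' S _
  simp only [coe_expMechanism, Measure.coe_finsetSum, Finset.sum_apply, Measure.smul_apply,
    smul_eq_mul, Finset.mul_sum]
  refine Finset.sum_le_sum fun y _ => ?_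
  rw [← mul_assoc, ← ENNReal.ofReal_mul (Real.exp_pos _).le]
  gcongr
  have h1 := expWeight_le_mul hα x x' y
  have h2 := expPartition_le_mul hα T x' x
  rw [dist_comm x' x] at h2
  have hp := expPartition_pos α hT x
  have hp' := expPartition_pos α hT x'
  rw [← mul_div_assoc, div_le_div_iff₀ hp hp']
  have hexp : Real.exp (α * dist x x') =
      Real.exp (α * dist x x' / 2) * Real.exp (α * dist x x' / 2) := by
    rw [← Real.exp_add]; congr 1; ring
  calc expWeight α x y * expPartition α T x'
      ≤ (Real.exp (α * dist x x' / 2) * expWeight α x' y) *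
          (Real.exp (α * dist x x' / 2) * expPartition α T x) := by
        gcongr
        exact mul_nonneg (Real.exp_pos _).le (expWeight_pos α x' y).le
    _ = _ := by rw [hexp]; ring

/-- The mechanism outputs each point at distance more than `t` with probability at most
`exp (-α (t - δ) / 2)`, since some point of the `δ`-net `T` has weight at least
`exp (-α δ / 2)`. -/
theorem optimalAccuracy_le_of_net [BorelSpace Z] {α : ℝ} (hα : 0 ≤ α) (T : Finset Z)
    (hT : T.Nonempty) {δ t : ℝ} (ht : 0 ≤ t) (hnet : ∀ x : Z, ∃ y ∈ T, dist x y ≤ δ)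
    (hdiam : ∀ x y : Z, dist x y ≤ 1) :
    optimalAccuracy Z α ≤ ENNReal.ofReal (t + T.card * Real.exp (-(α * (t - δ) / 2))) := by
  refine (iInf₂_le (expMechanism α T hT) (isMetricallyPrivate_expMechanism hα hT)).trans ?_
  refine iSup_le fun x => ?_
  have hp := expPartition_pos α hT x
  rw [coe_expMechanism, lintegral_finsetSum_measure]
  simp only [lintegral_smul_measure, lintegral_dirac, smul_eq_mul]
  simp only [edist_dist]
  simp_rw [← ENNReal.ofReal_mul (div_nonneg (expWeight_pos α x _).le hp.le)]
  rw [← ENNReal.ofReal_sum_of_nonneg fun y _ =>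
    mul_nonneg (div_nonneg (expWeight_pos α x y).le hp.le) dist_nonneg]
  refine ENNReal.ofReal_le_ofReal ?_
  have hlow : Real.exp (-(α * δ / 2)) ≤ expPartition α T x := by
    obtain ⟨y, hy, hxy⟩ := hnet x
    refine le_trans ?_ (Finset.single_le_sum (f := fun y => expWeight α x y)
      (fun y _ => (expWeight_pos α x y).le) hy)
    refine Real.exp_le_exp.2 ?_
    have := mul_le_mul_of_nonneg_left hxy hα
    linarith
  have hterm : ∀ y ∈ T, expWeight α x y / expPartition α T x * dist y x ≤
      expWeight α x y / expPartition α T x * t + Real.exp (-(α * (t - δ) / 2)) := by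
    intro y _
    have hq : 0 ≤ expWeight α x y / expPartition α T x :=
      div_nonneg (expWeight_pos α x y).le hp.le
    rcases le_or_gt (dist y x) t with h | h
    · have := mul_le_mul_of_nonneg_left h hq
      linarith [Real.exp_pos (-(α * (t - δ) / 2))]
    · have h1 : expWeight α x y ≤ Real.exp (-(α * t / 2)) := by
        refine Real.exp_le_exp.2 ?_
        rw [dist_comm] at h
        have := mul_le_mul_of_nonneg_left h.le hα
        linarith
      have h2 : expWeight α x y / expPartition α T x ≤ Real.exp (-(α * (t - δ) / 2)) := by
        rw [div_le_iff₀ hp]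
        calc expWeight α x y ≤ Real.exp (-(α * t / 2)) := h1
          _ = Real.exp (-(α * (t - δ) / 2)) * Real.exp (-(α * δ / 2)) := by
            rw [← Real.exp_add]; congr 1; ring
          _ ≤ _ := by gcongr
      have h3 := mul_le_mul_of_nonneg_left (hdiam y x) hq
      have h4 := mul_nonneg hq ht
      linarith
  refine (Finset.sum_le_sum hterm).trans (le_of_eq ?_)
  rw [Finset.sum_add_distrib, ← Finset.sum_mul, ← Finset.sum_div, ← expPartition,
    div_self hp.ne', one_mul, Finset.sum_const, nsmul_eq_mul]

end ExponentialMechanism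

/-! ### Nets and separated families -/

section Packing

variable {Z : Type*} [MetricSpace Z]

/-- An upper bound on the size of a net bounds the entropic scale: balls of radius at most `δ` hold
no two points at distance more than `2 δ`, so that only radii above `δ` matter. -/
theorem entropicScale_le_of_net {α : ℝ} (hα : 0 ≤ α) (T : Finset Z) {δ : ℝ≥0} (hδ : 0 < δ)
    (hnet : ∀ x : Z, ∃ y ∈ T, dist x y ≤ δ) (hcard : (T.card : ℝ) ≤ Real.exp (α * δ)) :
    entropicScale Z α ≤ (2 * δ : ℝ≥0) := by
  refine iInf₂_le (2 * δ) ⟨by positivity, fun x r hr => ?_⟩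
  rcases le_or_gt r δ with h | h
  · have h1 : Metric.packingNumber (2 * δ) (Metric.closedBall x r) ≤ 1 := by
      refine iSup₂_le fun C hC => iSup_le fun hsep => ?_
      rw [Set.encard_le_one_iff]
      intro a b ha hb
      by_contra hab
      have h2 : ((2 * δ : ℝ≥0) : ℝ≥0∞) < edist a b := hsep ha hb hab
      rw [edist_nndist, ENNReal.coe_lt_coe, ← NNReal.coe_lt_coe, coe_nndist] at h2
      have h3 := dist_triangle_right a b x
      have h4 := Metric.mem_closedBall.1 (hC ha)
      have h5 := Metric.mem_closedBall.1 (hC hb)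
      push_cast at h2
      linarith
    calc ((Metric.packingNumber (2 * δ) (Metric.closedBall x r) : ℕ∞) : ℝ≥0∞)
        ≤ ((1 : ℕ∞) : ℝ≥0∞) := ENat.toENNReal_le.2 h1
      _ = ENNReal.ofReal 1 := by simp
      _ ≤ _ := ENNReal.ofReal_le_ofReal (Real.one_le_exp (by positivity))
  · have h1 : Metric.packingNumber (2 * δ) (Metric.closedBall x r) ≤ (T.card : ℕ∞) := by
      refine (Metric.packingNumber_two_mul_le_externalCoveringNumber δ _).trans ?_
      have hc : Metric.IsCover δ (Metric.closedBall x r) (T : Set Z) := by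
        intro y _
        obtain ⟨z, hz, hyz⟩ := hnet y
        refine ⟨z, hz, ?_⟩
        change edist y z ≤ δ
        rw [edist_nndist, ENNReal.coe_le_coe, ← NNReal.coe_le_coe, coe_nndist]
        exact hyz
      refine (hc.externalCoveringNumber_le_encard).trans (by simp)
    calc ((Metric.packingNumber (2 * δ) (Metric.closedBall x r) : ℕ∞) : ℝ≥0∞)
        ≤ ((T.card : ℕ∞) : ℝ≥0∞) := ENat.toENNReal_le.2 h1
      _ = ENNReal.ofReal T.card := by simp
      _ ≤ _ := ENNReal.ofReal_le_ofReal (hcard.trans (Real.exp_le_exp.2 (by gcongr)))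

theorem le_entropicScale_of_separated {ι : Type*} {α r : ℝ} (hr : 0 < r) {s : ℝ≥0}
    (C : Finset ι) (z : ι → Z) (x : Z) (hball : ∀ i ∈ C, dist (z i) x ≤ r)
    (hsep : ∀ i ∈ C, ∀ j ∈ C, i ≠ j → s < dist (z i) (z j))
    (hcard : Real.exp (α * r) < C.card) : (s : ℝ≥0∞) ≤ entropicScale Z α := by
  refine le_iInf₂ fun t ⟨_, ht⟩ => ?_
  by_contra! hlt
  have hinj : Set.InjOn z C := by
    intro i hi j hj hij
    by_contra hne
    have := hsep i hi j hj hne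
    rw [hij, dist_self] at this
    exact absurd this (not_lt.2 s.2)
  have h1 : (C.card : ℕ∞) ≤ Metric.packingNumber t (Metric.closedBall x r) := by
    have hs : Metric.IsSeparated (t : ℝ≥0∞) (z '' C) := by
      rintro _ ⟨i, hi, rfl⟩ _ ⟨j, hj, rfl⟩ hne
      refine hlt.trans ?_
      rw [edist_nndist, ENNReal.coe_lt_coe, ← NNReal.coe_lt_coe, coe_nndist]
      exact hsep i hi j hj fun h => hne (congrArg z h)
    have := Metric.IsSeparated.encard_le_packingNumber
      (A := Metric.closedBall x r) (by rintro _ ⟨i, hi, rfl⟩; exact hball i hi) hs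
    rwa [hinj.encard_image, Set.encard_coe_eq_coe_finsetCard] at this
  have h2 := (ENat.toENNReal_le.2 h1).trans (ht x r hr)
  rw [ENat.toENNReal_coe, ← ENNReal.ofReal_natCast,
    ENNReal.ofReal_le_ofReal_iff (Real.exp_pos _).le] at h2
  linarith

/-- The packing argument: the balls of radius `s / 2` about the points of a separated family are
disjoint. By privacy their probabilities, each for the input at its centre, add up to at most
`exp (α r)`, and thus for more than `2 exp (α r)` centres one is at most `1 / 2`. -/
theorem le_optimalAccuracy_of_separated [MeasurableSpace Z] [BorelSpace Z] {ι : Type*} {α r : ℝ}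
    (hα : 0 ≤ α) {s : ℝ≥0} (C : Finset ι) (z : ι → Z) (x : Z)
    (hball : ∀ i ∈ C, dist (z i) x ≤ r)
    (hsep : ∀ i ∈ C, ∀ j ∈ C, i ≠ j → s < dist (z i) (z j))
    (hcard : 2 * Real.exp (α * r) < C.card) :
    ((s / 4 : ℝ≥0) : ℝ≥0∞) ≤ optimalAccuracy Z α := by
  refine le_iInf₂ fun M hM => ?_
  set B : ι → Set Z := fun i => Metric.closedBall (z i) (s / 2) with hB
  have hBm : ∀ i, MeasurableSet (B i) := fun i => Metric.isClosed_closedBall.measurableSet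
  have hdisj : (C : Set ι).PairwiseDisjoint B := by
    intro i hi j hj hij
    refine Metric.closedBall_disjoint_closedBall ?_
    have := hsep i hi j hj hij
    linarith
  have hsum : ∑ i ∈ C, (M (z i) : Measure Z) (B i) ≤ ENNReal.ofReal (Real.exp (α * r)) := by
    calc ∑ i ∈ C, (M (z i) : Measure Z) (B i)
        ≤ ∑ i ∈ C, ENNReal.ofReal (Real.exp (α * r)) * (M x : Measure Z) (B i) := by
          refine Finset.sum_le_sum fun i hi => (hM (z i) x (B i) (hBm i)).trans ?_
          gcongr
          exact hball i hi
      _ = ENNReal.ofReal (Real.exp (α * r)) * (M x : Measure Z) (⋃ i ∈ C, B i) := by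
          rw [← Finset.mul_sum, measure_biUnion_finset hdisj fun i _ => hBm i]
      _ ≤ _ := mul_le_of_le_one_right' prob_le_one
  obtain ⟨i, hi, hle⟩ : ∃ i ∈ C, (M (z i) : Measure Z) (B i) ≤ 2⁻¹ := by
    by_contra! hcon
    have h1 : (C.card : ℝ≥0∞) * 2⁻¹ ≤ ENNReal.ofReal (Real.exp (α * r)) := by
      refine le_trans ?_ hsum
      rw [← nsmul_eq_mul, ← Finset.sum_const]
      exact Finset.sum_le_sum fun i hi => (hcon i hi).le
    have h2 : (C.card : ℝ≥0∞) * 2⁻¹ = ENNReal.ofReal (C.card / 2) := by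
      rw [ENNReal.ofReal_div_of_pos (by norm_num), ENNReal.ofReal_natCast, ENNReal.ofReal_ofNat,
        div_eq_mul_inv]
    rw [h2, ENNReal.ofReal_le_ofReal_iff (Real.exp_pos _).le] at h1
    linarith
  have hcompl : (2⁻¹ : ℝ≥0∞) ≤ (M (z i) : Measure Z) (B i)ᶜ := by
    rw [prob_compl_eq_one_sub (hBm i)]
    refine ENNReal.le_sub_of_add_le_left (measure_ne_top _ _) ?_
    calc (M (z i) : Measure Z) (B i) + 2⁻¹ ≤ 2⁻¹ + 2⁻¹ := by gcongr
      _ = 1 := ENNReal.inv_two_add_inv_two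
  refine le_trans ?_ (le_iSup (fun x => ∫⁻ y, edist y x ∂(M x : Measure Z)) (z i))
  calc ((s / 4 : ℝ≥0) : ℝ≥0∞) = ((s / 2 : ℝ≥0) : ℝ≥0∞) * 2⁻¹ := by
        rw [show s / 4 = s / 2 * 2⁻¹ by
          rw [← div_eq_mul_inv, div_div]; norm_num]
        rw [ENNReal.coe_mul, ENNReal.coe_inv two_ne_zero, ENNReal.coe_ofNat]
    _ ≤ ((s / 2 : ℝ≥0) : ℝ≥0∞) *
          (M (z i) : Measure Z) {y | ((s / 2 : ℝ≥0) : ℝ≥0∞) ≤ edist y (z i)} := by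
        gcongr
        refine hcompl.trans (measure_mono fun y hy => ?_)
        change ((s / 2 : ℝ≥0) : ℝ≥0∞) ≤ edist y (z i)
        rw [edist_nndist, ENNReal.coe_le_coe, ← NNReal.coe_le_coe, coe_nndist]
        push_cast
        exact (not_le.1 (show ¬dist y (z i) ≤ s / 2 from hy)).le
    _ ≤ _ := mul_meas_ge_le_lintegral (measurable_edist_left) _

end Packing

/-! ### The Gilbert–Varshamov bound -/

section Code

variable {ι : Type*} [Fintype ι]

/-- Chernoff's bound for the size of a Hamming ball, with the parameter `1`. -/
theorem card_hammingBall_le [DecidableEq ι] (c : ι → Bool) :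
    ((Finset.univ.filter fun e : ι → Bool => 4 * hammingDist c e < Fintype.card ι).card : ℝ) ≤
      (Real.exp (1 / 4) * (1 + Real.exp (-1))) ^ Fintype.card ι := by
  set n := Fintype.card ι
  have hsum : ∑ e : ι → Bool, Real.exp (-1) ^ hammingDist c e = (1 + Real.exp (-1)) ^ n := by
    have h1 : ∀ e : ι → Bool, Real.exp (-1) ^ hammingDist c e =
        ∏ i, if c i ≠ e i then Real.exp (-1) else 1 := by
      intro e
      rw [Finset.prod_ite, Finset.prod_const, Finset.prod_const_one, mul_one, hammingDist]
    simp_rw [h1]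
    rw [← Fintype.piFinset_univ, ← Finset.prod_univ_sum (fun _ => Finset.univ)
      fun i b => if c i ≠ b then Real.exp (-1) else 1]
    have h2 : ∀ i, ∑ b : Bool, (if c i ≠ b then Real.exp (-1) else 1) = 1 + Real.exp (-1) := by
      intro i
      cases c i <;> simp [add_comm]
    simp_rw [h2]
    rw [Finset.prod_const, Finset.card_univ]
  rw [mul_pow, ← hsum, Finset.mul_sum]
  calc ((Finset.univ.filter fun e : ι → Bool => 4 * hammingDist c e < n).card : ℝ)
      = ∑ e ∈ Finset.univ.filter fun e : ι → Bool => 4 * hammingDist c e < n, (1 : ℝ) := by simp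
    _ ≤ ∑ e ∈ Finset.univ.filter fun e : ι → Bool => 4 * hammingDist c e < n,
          Real.exp (1 / 4) ^ n * Real.exp (-1) ^ hammingDist c e := by
        refine Finset.sum_le_sum fun e he => ?_
        have h : (4 * hammingDist c e : ℝ) < n := by
          exact_mod_cast (Finset.mem_filter.1 he).2
        rw [← Real.exp_nat_mul, ← Real.exp_nat_mul, ← Real.exp_add]
        refine Real.one_le_exp ?_
        linarith
    _ ≤ _ := Finset.sum_le_sum_of_subset_of_nonneg (Finset.filter_subset _ _)
        fun e _ _ => by positivity

/-- The Gilbert–Varshamov bound, for codes of relative distance `1 / 4`. -/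
theorem exists_code_exp_le_card (ι : Type*) [Fintype ι] [Nonempty ι] :
    ∃ C : Finset (ι → Bool),
      (∀ c ∈ C, ∀ c' ∈ C, c ≠ c' → Fintype.card ι ≤ 4 * hammingDist c c') ∧
      Real.exp (Fintype.card ι / 10) ≤ C.card := by
  classical
  set n := Fintype.card ι with hn
  let P : Finset (ι → Bool) → Prop :=
    fun C => ∀ c ∈ C, ∀ c' ∈ C, c ≠ c' → n ≤ 4 * hammingDist c c'
  obtain ⟨C, hC⟩ := Set.Finite.exists_maximal (s := {C | P C}) (Set.toFinite _)
    ⟨∅, by simp [P]⟩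
  refine ⟨C, hC.prop, ?_⟩
  -- by maximality, the balls about the code words cover everything
  have hcover : (Finset.univ : Finset (ι → Bool)) ⊆
      C.biUnion fun c => Finset.univ.filter fun e : ι → Bool => 4 * hammingDist c e < n := by
    intro e _
    by_contra hcon
    simp only [Finset.mem_biUnion, Finset.mem_filter, Finset.mem_univ, true_and, not_exists,
      not_and, not_lt] at hcon
    have hP : P (insert e C) := by
      intro c hc c' hc' hne
      rw [Finset.mem_insert] at hc hc'
      rcases hc with rfl | hc <;> rcases hc' with rfl | hc'
      · exact absurd rfl hne
      · rw [hammingDist_comm]; exact hcon c' hc'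
      · exact hcon c hc
      · exact hC.prop c hc c' hc' hne
    have he : e ∈ C := hC.le_of_ge hP (Finset.subset_insert e C) (Finset.mem_insert_self e C)
    have h1 := hcon e he
    rw [hammingDist_self] at h1
    have h0 : 0 < n := Fintype.card_pos
    omega
  have hcard : (2 : ℝ) ^ n ≤ C.card * (Real.exp (1 / 4) * (1 + Real.exp (-1))) ^ n := by
    have h1 := (Finset.card_le_card hcover).trans Finset.card_biUnion_le
    have h2 : (2 : ℝ) ^ n ≤ ∑ c ∈ C,
        ((Finset.univ.filter fun e : ι → Bool => 4 * hammingDist c e < n).card : ℝ) := by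
      rw [Finset.card_univ, Fintype.card_fun, Fintype.card_bool] at h1
      exact_mod_cast h1
    refine h2.trans ((Finset.sum_le_sum fun c _ => card_hammingBall_le c).trans ?_)
    rw [Finset.sum_const, nsmul_eq_mul]
  have hnum : Real.exp (1 / 10) * (Real.exp (1 / 4) * (1 + Real.exp (-1))) ≤ 2 := by
    have h1 : Real.exp (1 / 10) * (Real.exp (1 / 4) * (1 + Real.exp (-1))) =
        (Real.exp 1 + 1) / Real.exp (13 / 20) := by
      rw [eq_div_iff (Real.exp_pos _).ne']
      have e1 : Real.exp (1 / 10) * Real.exp (1 / 4) * Real.exp (13 / 20) = Real.exp 1 := by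
        rw [← Real.exp_add, ← Real.exp_add]; norm_num
      have e2 : Real.exp 1 * Real.exp (-1) = 1 := by rw [← Real.exp_add]; simp
      calc _ = Real.exp (1 / 10) * Real.exp (1 / 4) * Real.exp (13 / 20) *
            (1 + Real.exp (-1)) := by ring
        _ = _ := by rw [e1, mul_add, e2, mul_one]
    rw [h1, div_le_iff₀ (Real.exp_pos _)]
    have h2 := Real.quadratic_le_exp_of_nonneg (x := 13 / 20) (by norm_num)
    have h3 := Real.exp_one_lt_d9
    norm_num at h2
    linarith
  have hpos : 0 < (Real.exp (1 / 4) * (1 + Real.exp (-1))) ^ n := by positivity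
  refine le_of_mul_le_mul_right ?_ hpos
  refine le_trans ?_ hcard
  rw [show (n : ℝ) / 10 = n * (1 / 10) by ring, Real.exp_nat_mul, ← mul_pow]
  exact pow_le_pow_left₀ (by positivity) hnum n

end Code

/-! ### A separated family of probability measures -/

section SeparatedFamily

/-- The grid point `v / k`, and next to it the centre of the cell whose lowest corner it is. -/
noncomputable def cellPoint {d k : ℕ} (v : Fin d → Fin k) (b : Bool) : UnitCube d := fun i =>
  ⟨((v i : ℕ) + if b then 1 / 2 else 0) / k, by positivity, by
    have h : ((v i : ℕ) : ℝ) + 1 ≤ k := by exact_mod_cast (v i).2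
    rw [div_le_one (by linarith [Nat.cast_nonneg (α := ℝ) (v i : ℕ)])]
    split_ifs <;> linarith⟩

theorem edist_cellPoint_le {d k : ℕ} (v : Fin d → Fin k) (b b' : Bool) :
    edist (cellPoint v b) (cellPoint v b') ≤ ENNReal.ofReal (1 / (2 * k)) := by
  refine edist_unitCube_le_ofReal (by positivity) fun i => ?_
  have hk : (0 : ℝ) < k := by exact_mod_cast (v i).pos
  simp only [cellPoint]
  rw [← sub_div, abs_div, abs_of_pos hk, ← div_div]
  gcongr
  cases b <;> cases b' <;> norm_num [abs_le]

theorem le_edist_cellPoint {d k : ℕ} (hd : 1 ≤ d) {v v' : Fin d → Fin k} {b b' : Bool}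
    (h : v = v' → b ≠ b') :
    ENNReal.ofReal (1 / (2 * k)) ≤ edist (cellPoint v b) (cellPoint v' b') := by
  obtain ⟨i, hi⟩ : ∃ i, (1 / 2 : ℝ) ≤
      |((v i : ℕ) + if b then 1 / 2 else 0) - ((v' i : ℕ) + if b' then 1 / 2 else 0 : ℝ)| := by
    by_cases hv : v = v'
    · subst hv
      refine ⟨⟨0, hd⟩, ?_⟩
      have := h rfl
      cases b <;> cases b' <;> simp_all
    · obtain ⟨i, hi⟩ := Function.ne_iff.1 hv
      refine ⟨i, ?_⟩
      have h1 : (v i : ℕ) ≠ v' i := fun h => hi (Fin.ext h)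
      rw [le_abs]
      rcases lt_or_gt_of_ne h1 with h2 | h2
      · have h3 : ((v i : ℕ) : ℝ) + 1 ≤ (v' i : ℕ) := by exact_mod_cast h2
        right; split_ifs <;> linarith
      · have h3 : ((v' i : ℕ) : ℝ) + 1 ≤ (v i : ℕ) := by exact_mod_cast h2
        left; split_ifs <;> linarith
  have hk : (0 : ℝ) < k := by exact_mod_cast (v i).pos
  refine le_trans ?_ (edist_le_pi_edist _ _ i)
  rw [edist_dist, Subtype.dist_eq, Real.dist_eq]
  refine ENNReal.ofReal_le_ofReal ?_
  simp only [cellPoint]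
  rw [← sub_div, abs_div, abs_of_pos hk, ← div_div]
  gcongr

/-- The uniform distribution on one point from each cell of side `1 / k`, where `ε` selects
the corner or the centre of each cell. -/
noncomputable def cellMeasure {d k : ℕ} (ε : (Fin d → Fin k) → Bool) : Measure (UnitCube d) :=
  ∑ v, ((k ^ d : ℕ) : ℝ≥0∞)⁻¹ • Measure.dirac (cellPoint v (ε v))

theorem cellMeasure_apply {d k : ℕ} (ε : (Fin d → Fin k) → Bool) {S : Set (UnitCube d)}
    (hS : MeasurableSet S) [DecidablePred fun v => cellPoint v (ε v) ∈ S] :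
    cellMeasure ε S = ((k ^ d : ℕ) : ℝ≥0∞)⁻¹ *
      (Finset.univ.filter fun v => cellPoint v (ε v) ∈ S).card := by
  simp only [cellMeasure, Measure.coe_finsetSum, Finset.sum_apply, Measure.smul_apply, smul_eq_mul,
    Measure.dirac_apply' _ hS, ← Finset.mul_sum, Set.indicator_apply, Pi.one_apply,
    Finset.sum_boole]

instance isProbabilityMeasure_cellMeasure {d k : ℕ} [NeZero k] (ε : (Fin d → Fin k) → Bool) :
    IsProbabilityMeasure (cellMeasure ε) := by
  classical
  constructor
  rw [cellMeasure_apply ε MeasurableSet.univ]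
  simp only [Set.mem_univ, Finset.filter_true, Finset.card_univ, Fintype.card_fun,
    Fintype.card_fin]
  exact ENNReal.inv_mul_cancel (by exact_mod_cast (pow_pos (NeZero.pos k) d).ne')
    (ENNReal.natCast_ne_top _)

theorem wassersteinEDist_cellMeasure_le {d k : ℕ} [NeZero k] (ε ε' : (Fin d → Fin k) → Bool) :
    wassersteinEDist (cellMeasure ε) (cellMeasure ε') ≤ ENNReal.ofReal (1 / (2 * k)) := by
  refine (wassersteinEDist_le (∑ v, ((k ^ d : ℕ) : ℝ≥0∞)⁻¹ •
    Measure.dirac (cellPoint v (ε v), cellPoint v (ε' v))) ?_ ?_).trans ?_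
  · rw [Measure.fst, ← Measure.mapₗ_apply_of_measurable measurable_fst, map_sum]
    refine Finset.sum_congr rfl fun v _ => ?_
    rw [Measure.mapₗ_apply_of_measurable measurable_fst, Measure.map_smul,
      Measure.map_dirac' measurable_fst]
  · rw [Measure.snd, ← Measure.mapₗ_apply_of_measurable measurable_snd, map_sum]
    refine Finset.sum_congr rfl fun v _ => ?_
    rw [Measure.mapₗ_apply_of_measurable measurable_snd, Measure.map_smul,
      Measure.map_dirac' measurable_snd]
  · rw [lintegral_finsetSum_measure]
    simp only [lintegral_smul_measure, lintegral_dirac, smul_eq_mul]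
    calc _ ≤ ∑ _v : Fin d → Fin k, ((k ^ d : ℕ) : ℝ≥0∞)⁻¹ * ENNReal.ofReal (1 / (2 * k)) := by
          gcongr with v
          exact edist_cellPoint_le v _ _
      _ = (((k ^ d : ℕ) : ℝ≥0∞) * ((k ^ d : ℕ) : ℝ≥0∞)⁻¹) * ENNReal.ofReal (1 / (2 * k)) := by
          rw [Finset.sum_const, Finset.card_univ, Fintype.card_fun, Fintype.card_fin,
            Fintype.card_fin, nsmul_eq_mul, mul_assoc]
      _ ≤ _ := mul_le_of_le_one_left' (ENNReal.mul_inv_le_one _)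

theorem le_wassersteinEDist_cellMeasure {d k : ℕ} (hd : 1 ≤ d) [NeZero k]
    {ε ε' : (Fin d → Fin k) → Bool} (h : k ^ d ≤ 4 * hammingDist ε ε') :
    ENNReal.ofReal (1 / (8 * k)) ≤ wassersteinEDist (cellMeasure ε) (cellMeasure ε') := by
  classical
  set A : Set (UnitCube d) := (fun v => cellPoint v (ε v)) '' {v | ε v ≠ ε' v} with hA
  set B : Set (UnitCube d) := Set.range fun v => cellPoint v (ε' v) with hB
  have hAm : MeasurableSet A := (Set.toFinite _).measurableSet
  have hBm : MeasurableSet B := (Set.finite_range _).measurableSet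
  have hk : (0 : ℝ) < k := by exact_mod_cast NeZero.pos k
  have hkd : (0 : ℝ) < (k : ℝ) ^ d := by positivity
  have hBc : cellMeasure ε' Bᶜ = 0 := by
    rw [cellMeasure_apply ε' hBm.compl]
    simp [hB]
  have hAμ : ENNReal.ofReal (1 / 4) ≤ cellMeasure ε A := by
    have h1 : hammingDist ε ε' ≤ (Finset.univ.filter fun v => cellPoint v (ε v) ∈ A).card := by
      rw [hammingDist]
      refine Finset.card_le_card fun v hv => ?_
      rw [Finset.mem_filter] at hv ⊢
      exact ⟨hv.1, v, hv.2, rfl⟩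
    rw [cellMeasure_apply ε hAm]
    refine le_trans ?_ (mul_le_mul_right (Nat.cast_le.2 h1) _)
    have h2 : ((k : ℝ) ^ d) ≤ 4 * hammingDist ε ε' := by exact_mod_cast h
    rw [← ENNReal.ofReal_natCast (k ^ d), ← ENNReal.ofReal_inv_of_pos (by exact_mod_cast hkd),
      ← ENNReal.ofReal_natCast, ← ENNReal.ofReal_mul (by positivity)]
    refine ENNReal.ofReal_le_ofReal ?_
    rw [Nat.cast_pow, inv_mul_eq_div, le_div_iff₀ hkd]
    linarith
  calc ENNReal.ofReal (1 / (8 * k)) = ENNReal.ofReal (1 / (2 * k)) * ENNReal.ofReal (1 / 4) := by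
        rw [← ENNReal.ofReal_mul (by positivity)]
        congr 1
        field_simp
        norm_num
    _ ≤ ENNReal.ofReal (1 / (2 * k)) * cellMeasure ε A := by gcongr
    _ ≤ _ := by
      refine mul_measure_le_wassersteinEDist _ _ hAm hBm hBc ?_
      rintro _ ⟨v, hv, rfl⟩ _ ⟨v', rfl⟩
      exact le_edist_cellPoint hd fun h => h ▸ hv

/-- A ball of radius `1 / (2 k)` in the space of probability measures holds a family of measures,
separated by `1 / (9 k)`, whose size is exponential in the number `k ^ d` of cells. -/
theorem exists_separated_family (d k : ℕ) (hd : 1 ≤ d) (hk : 1 ≤ k) :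
    ∃ (C : Finset ((Fin d → Fin k) → Bool))
      (z : ((Fin d → Fin k) → Bool) → WassersteinSpace (UnitCube d))
      (x : WassersteinSpace (UnitCube d)),
      (∀ i ∈ C, dist (z i) x ≤ 1 / (2 * k)) ∧
      (∀ i ∈ C, ∀ j ∈ C, i ≠ j → 1 / (9 * k : ℝ) < dist (z i) (z j)) ∧
      Real.exp ((k : ℝ) ^ d / 10) ≤ C.card := by
  have : NeZero k := ⟨by omega⟩
  have hk0 : (0 : ℝ) < k := by exact_mod_cast hk
  obtain ⟨C, hsep, hcard⟩ := exists_code_exp_le_card (Fin d → Fin k)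
  have hn : Fintype.card (Fin d → Fin k) = k ^ d := by simp
  rw [hn] at hcard
  simp only [hn] at hsep
  let z : ((Fin d → Fin k) → Bool) → WassersteinSpace (UnitCube d) :=
    fun ε => ⟨⟨cellMeasure ε, inferInstance⟩⟩
  refine ⟨C, z, z fun _ => false, fun i _ => ?_, fun i hi j hj hij => ?_, by exact_mod_cast hcard⟩
  · exact ENNReal.toReal_le_of_le_ofReal (by positivity) (wassersteinEDist_cellMeasure_le _ _)
  · have h1 : 1 / (8 * k : ℝ) ≤ dist (z i) (z j) :=
      (ENNReal.ofReal_le_iff_le_toReal (wassersteinEDist_ne_top _ _)).1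
        (le_wassersteinEDist_cellMeasure hd (hsep i hi j hj hij))
    refine lt_of_lt_of_le ?_ h1
    gcongr
    norm_num

end SeparatedFamily

/-! ### The bounds for the cube -/

section Asymptotics

theorem dist_wassersteinSpace_unitCube_le_one {d : ℕ} (μ ν : WassersteinSpace (UnitCube d)) :
    dist μ ν ≤ 1 := by
  refine ENNReal.toReal_le_of_le_ofReal zero_le_one ?_
  refine (wassersteinEDist_le ((μ.toProbabilityMeasure : Measure (UnitCube d)).prod
    (ν.toProbabilityMeasure : Measure (UnitCube d))) (by simp) (by simp)).trans ?_
  refine (lintegral_mono fun p : UnitCube d × UnitCube d =>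
    edist_unitCube_le_one p.1 p.2).trans ?_
  simp

theorem entropicScale_and_optimalAccuracy_le (d : ℕ) (hd : 1 ≤ d) {β : ℝ} (hβ : 0 < β) :
    entropicScale (WassersteinSpace (UnitCube d)) (β ^ (d + 1)) ≤
        ENNReal.ofReal (12 * min β⁻¹ 1) ∧
      optimalAccuracy (WassersteinSpace (UnitCube d)) (β ^ (d + 1)) ≤
        ENNReal.ofReal (20 * min β⁻¹ 1) := by
  have hα : 0 ≤ β ^ (d + 1) := by positivity
  rcases le_or_gt 1 β with h1 | h1
  · set k := ⌊β⌋₊ with hk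
    have hk1 : 1 ≤ k := Nat.one_le_floor_iff β |>.2 h1
    have hkβ : (k : ℝ) ≤ β := Nat.floor_le hβ.le
    have hβk : β ≤ 2 * k := by
      have h2 := Nat.lt_floor_add_one β
      have h3 : (1 : ℝ) ≤ k := by exact_mod_cast hk1
      linarith
    have hk0 : (0 : ℝ) < k := by exact_mod_cast hk1
    have hinv : 1 / (k : ℝ) ≤ 2 * β⁻¹ := by
      rw [← div_eq_mul_inv, div_le_div_iff₀ hk0 hβ]
      linarith
    rw [min_eq_left (inv_le_one_of_one_le₀ h1)]
    obtain ⟨T, hTcard, hTnet⟩ := exists_finset_card_le_forall_dist_le d k hd hk1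
    have hTne : T.Nonempty := by
      obtain ⟨ν, hν, -⟩ := hTnet ⟨⟨Measure.dirac 0, inferInstance⟩⟩
      exact ⟨ν, hν⟩
    set n : ℕ := k ^ d with hn
    -- with respect to the scale `1 / k`, the parameter `α` is at least the number of cells
    have hαk : (n : ℝ) ≤ β ^ (d + 1) / k := by
      rw [le_div_iff₀ hk0, hn, Nat.cast_pow, ← pow_succ]
      exact pow_le_pow_left₀ hk0.le hkβ _
    have hcard : (T.card : ℝ) ≤ Real.exp (2 * n) := by
      have h4 : (4 : ℝ) ≤ Real.exp 2 := by
        have := Real.quadratic_le_exp_of_nonneg (x := 2) (by norm_num)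
        linarith
      calc (T.card : ℝ) ≤ 4 ^ n := by exact_mod_cast hTcard
        _ ≤ Real.exp 2 ^ n := pow_le_pow_left₀ (by norm_num) h4 n
        _ = Real.exp (2 * n) := by rw [← Real.exp_nat_mul, mul_comm]
    constructor
    · have hδ : ((3 / k : ℝ≥0) : ℝ) = 3 / k := by push_cast; rfl
      refine (entropicScale_le_of_net hα T (δ := 3 / k) (by positivity)
        (by simpa only [hδ] using hTnet) ?_).trans ?_
      · refine hcard.trans (Real.exp_le_exp.2 ?_)
        rw [hδ, mul_div_assoc']
        have : β ^ (d + 1) * 3 / k = 3 * (β ^ (d + 1) / k) := by ring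
        linarith [Nat.cast_nonneg (α := ℝ) n]
      · rw [← ENNReal.ofReal_coe_nnreal]
        refine ENNReal.ofReal_le_ofReal ?_
        rw [NNReal.coe_mul, hδ]
        have : ((2 : ℝ≥0) : ℝ) * (3 / k) = 6 * (1 / k) := by push_cast; ring
        linarith
    · refine (optimalAccuracy_le_of_net hα T hTne (δ := 3 / k) (t := 9 / k) (by positivity) hTnet
        dist_wassersteinSpace_unitCube_le_one).trans (ENNReal.ofReal_le_ofReal ?_)
      have hexp : (T.card : ℝ) * Real.exp (-(β ^ (d + 1) * (9 / k - 3 / k) / 2)) ≤ 1 / k := by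
        have h5 : β ^ (d + 1) * (9 / k - 3 / k) / 2 = 3 * (β ^ (d + 1) / k) := by ring
        have hkn : (k : ℝ) ≤ n := by exact_mod_cast Nat.le_self_pow (by omega) k
        calc (T.card : ℝ) * Real.exp (-(β ^ (d + 1) * (9 / k - 3 / k) / 2))
            ≤ Real.exp (2 * n) * Real.exp (-(3 * n)) := by
              rw [h5]; gcongr
          _ = (Real.exp n)⁻¹ := by
              rw [← Real.exp_add, ← Real.exp_neg]; congr 1; ring
          _ ≤ (k : ℝ)⁻¹ := by
              gcongr
              linarith [Real.add_one_le_exp (n : ℝ)]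
          _ = 1 / k := (one_div _).symm
      have h6 : (9 : ℝ) / k = 9 * (1 / k) := by ring
      linarith
  · rw [min_eq_right ((one_le_inv₀ hβ).2 h1.le)]
    let x : WassersteinSpace (UnitCube d) := ⟨⟨Measure.dirac 0, inferInstance⟩⟩
    have hnet : ∀ y : WassersteinSpace (UnitCube d), ∃ z ∈ ({x} : Finset _), dist y z ≤ 1 :=
      fun y => ⟨x, Finset.mem_singleton_self x, dist_wassersteinSpace_unitCube_le_one y x⟩
    constructor
    · refine (entropicScale_le_of_net hα {x} (δ := 1) one_pos hnet ?_).trans ?_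
      · rw [Finset.card_singleton, Nat.cast_one]
        exact Real.one_le_exp (by positivity)
      · rw [← ENNReal.ofReal_coe_nnreal]
        exact ENNReal.ofReal_le_ofReal (by norm_num)
    · refine (optimalAccuracy_le_of_net hα {x} (Finset.singleton_nonempty x) (δ := 1) (t := 1)
        zero_le_one hnet dist_wassersteinSpace_unitCube_le_one).trans
        (ENNReal.ofReal_le_ofReal ?_)
      norm_num

theorem le_entropicScale_and_optimalAccuracy (d : ℕ) (hd : 1 ≤ d) {β : ℝ} (hβ : 0 < β) :
    ENNReal.ofReal (min β⁻¹ 1 / 153) ≤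
        entropicScale (WassersteinSpace (UnitCube d)) (β ^ (d + 1)) ∧
      ENNReal.ofReal (min β⁻¹ 1 / 612) ≤
        optimalAccuracy (WassersteinSpace (UnitCube d)) (β ^ (d + 1)) := by
  set k := max 16 ⌈16 * β⌉₊ with hk
  have hk16 : 16 ≤ k := le_max_left _ _
  have hk16' : (16 : ℝ) ≤ k := by exact_mod_cast hk16
  have hk0 : (0 : ℝ) < k := by linarith
  have hkβ : 16 * β ≤ k := (Nat.le_ceil _).trans (by exact_mod_cast le_max_right _ _)
  -- the scale `1 / k` is comparable to the claimed one
  have hkm : k * min β⁻¹ 1 ≤ 17 := by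
    have hle : (k : ℝ) ≤ max 16 (16 * β + 1) := by
      rw [hk, Nat.cast_max]
      exact max_le_max (by norm_num) (Nat.ceil_lt_add_one (by positivity)).le
    rcases le_or_gt 1 β with h1 | h1
    · rw [min_eq_left (inv_le_one_of_one_le₀ h1), ← div_eq_mul_inv, div_le_iff₀ hβ]
      exact hle.trans (max_le (by linarith) (by linarith))
    · rw [min_eq_right ((one_le_inv₀ hβ).2 h1.le), mul_one]
      exact hle.trans (max_le (by linarith) (by linarith))
  have hm : min β⁻¹ 1 ≤ 17 / k := by rwa [le_div_iff₀' hk0]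
  obtain ⟨C, z, x, hball, hsep, hC⟩ := exists_separated_family d k hd (by omega)
  have hcard : 2 * Real.exp (β ^ (d + 1) * (1 / (2 * k))) < C.card := by
    refine lt_of_lt_of_le ?_ hC
    have hkd : (16 : ℝ) ≤ (k : ℝ) ^ d := hk16'.trans (le_self_pow₀ (by linarith) (by omega))
    have h1 : 16 * β ^ (d + 1) ≤ (k : ℝ) ^ d * k := by
      rw [← pow_succ]
      refine le_trans ?_ (pow_le_pow_left₀ (by positivity) hkβ (d + 1))
      rw [mul_pow]
      gcongr
      exact le_self_pow₀ (by norm_num) (by omega)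
    have h2 : β ^ (d + 1) * (1 / (2 * k)) ≤ (k : ℝ) ^ d / 32 := by
      rw [mul_one_div, div_le_div_iff₀ (by positivity) (by norm_num)]
      linarith
    have h3 : (2 : ℝ) < Real.exp (k ^ d / 10 - k ^ d / 32) := by
      linarith [Real.add_one_le_exp ((k : ℝ) ^ d / 10 - k ^ d / 32)]
    calc 2 * Real.exp (β ^ (d + 1) * (1 / (2 * k))) ≤ 2 * Real.exp (k ^ d / 32) := by gcongr
      _ < Real.exp (k ^ d / 10 - k ^ d / 32) * Real.exp (k ^ d / 32) := by gcongr
      _ = _ := by rw [← Real.exp_add]; congr 1; ring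
  have hs : ((1 / (9 * k) : ℝ≥0) : ℝ) = 1 / (9 * k) := by push_cast; rfl
  constructor
  · have h := le_entropicScale_of_separated (α := β ^ (d + 1)) (r := 1 / (2 * k))
      (s := 1 / (9 * k)) (by positivity) C z x hball (by simpa only [hs] using hsep)
      (by linarith [Real.exp_pos (β ^ (d + 1) * (1 / (2 * k)))])
    refine le_trans ?_ h
    rw [← ENNReal.ofReal_coe_nnreal, hs]
    refine ENNReal.ofReal_le_ofReal ?_
    have : 17 / (k : ℝ) / 153 = 1 / (9 * k) := by field_simp; norm_num
    linarith
  · have h := le_optimalAccuracy_of_separated (α := β ^ (d + 1)) (r := 1 / (2 * k))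
      (s := 1 / (9 * k)) (by positivity) C z x hball (by simpa only [hs] using hsep) hcard
    refine le_trans ?_ h
    rw [← ENNReal.ofReal_coe_nnreal, NNReal.coe_div, hs]
    refine ENNReal.ofReal_le_ofReal ?_
    have : 17 / (k : ℝ) / 612 = 1 / (9 * k) / ((4 : ℝ≥0) : ℝ) := by push_cast; field_simp; norm_num
    linarith

end Asymptotics

theorem theorem6p2 :
    ∃ c C : ℝ, 0 < c ∧ 0 < C ∧ ∀ d : ℕ, 1 ≤ d → ∀ α : ℝ, 0 < α →
      (ENNReal.ofReal c * entropicScale (WassersteinSpace (UnitCube d)) α ≤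
          optimalAccuracy (WassersteinSpace (UnitCube d)) α ∧
        optimalAccuracy (WassersteinSpace (UnitCube d)) α ≤
          ENNReal.ofReal C * entropicScale (WassersteinSpace (UnitCube d)) α) ∧
      (ENNReal.ofReal (c * min (α ^ (-(1 / ((d : ℝ) + 1)))) 1) ≤
          entropicScale (WassersteinSpace (UnitCube d)) α ∧
        entropicScale (WassersteinSpace (UnitCube d)) α ≤
          ENNReal.ofReal (C * min (α ^ (-(1 / ((d : ℝ) + 1)))) 1)) := by
  -- `7344 = 12 * 612` and `3060 = 20 * 153`
  refine ⟨1 / 7344, 3060, by norm_num, by norm_num, fun d hd α hα => ?_⟩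
  set β : ℝ := α ^ (1 / ((d : ℝ) + 1)) with hβdef
  have hβ : 0 < β := Real.rpow_pos_of_pos hα _
  have hαβ : β ^ (d + 1) = α := by
    rw [hβdef, ← Real.rpow_natCast, ← Real.rpow_mul hα.le]
    push_cast
    rw [one_div_mul_cancel (by positivity), Real.rpow_one]
  obtain ⟨hs, hA⟩ := entropicScale_and_optimalAccuracy_le d hd hβ
  obtain ⟨hs', hA'⟩ := le_entropicScale_and_optimalAccuracy d hd hβ
  rw [hαβ] at hs hA hs' hA'
  rw [Real.rpow_neg hα.le, ← hβdef]
  set m := min β⁻¹ 1 with hm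
  have hm0 : 0 < m := lt_min (inv_pos.2 hβ) one_pos
  refine ⟨⟨?_, ?_⟩, ?_, ?_⟩
  · refine le_trans (mul_le_mul_right hs _) (le_trans ?_ hA')
    rw [← ENNReal.ofReal_mul (by norm_num)]
    exact ENNReal.ofReal_le_ofReal (by linarith)
  · refine hA.trans (le_trans ?_ (mul_le_mul_right hs' _))
    rw [← ENNReal.ofReal_mul (by norm_num)]
    exact ENNReal.ofReal_le_ofReal (by linarith)
  · exact (ENNReal.ofReal_le_ofReal (by linarith)).trans hs'
  · exact hs.trans (ENNReal.ofReal_le_ofReal (by linarith))
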